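/- A \emph{gyrogroup} $(G,\oplus)$ is a set with a binary operation that has a (unique) two-sided identity $0$ and (unique) two-sided inverses $\ominus x$, and such that for all $x,y\in G$ there is an automorphism $\mathrm{gyr}[x,y]$ of $(G,\oplus)$ with $x\oplus(y\oplus z)=(x\oplus y)\oplus \mathrm{gyr}[x,y](z)$ for all $z\in G$ and $\mathrm{gyr}[x\oplus y,y]=\mathrm{gyr}[x,y]$. A \emph{strongly topological gyrogroup} is a gyrogroup $G$ with a $T_1$ topology such that $\oplus:G\times G\to G$ and $\ominus:G\to G$ are continuous and $0$ has a neighborhood base $\mathscr U$ with $\mathrm{gyr}[x,y](U)=U$ for all $U\in\mathscr U$ and $x,y\in G$. A subset $H\subseteq G$ is a \emph{subgyrogroup} if it is closed under $\oplus$ and is itself a gyrogroup under the restricted operation; it is an \emph{$L$-subgyrogroup} if moreover $\mathrm{gyr}[a,h](H)=H$ for all $a\in G$ and $h\in H$. Then $G/H$ denotes the set of left cosets $a\oplus H=\{a\oplus h:h\in H\}$, $a\in G$, with the quotient topology of the map $a\mapsto a\oplus H$. A topological space is \emph{\v{C}ech-complete} if it is Tychonoff and homeomorphic to a $G_\delta$-set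 in a compact Hausdorff space. \textbf{Theorem.} Let $G$ be a strongly topological gyrogroup. Then $G$ is \v{C}ech-complete if and only if it contains a compact $L$-subgyrogroup $H$ such that the quotient space $G/H$ is metrizable by a complete metric. Consequently, if $G$ is \v{C}ech-complete, then $G$ is paracompact, i.e. every open cover of $G$ has a locally finite open refinement that covers $G$. -/

import Mathlib

universe u

/-- A gyrogroup, written additively (`x + y` is the usual `x ⊕ y`, and `-x` is `⊖ x`).  The
uniqueness of the identity, of inverses and of the gyroautomorphisms is automatic, as shown
below. -/
class Gyrogroup (G : Type u) extends Add G, Zero G, Neg G where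
  /-- the gyroautomorphism `gyr[x, y]`, an automorphism of the groupoid `(G, +)` -/
  gyr : G → G → (G ≃+ G)
  zero_add : ∀ a : G, 0 + a = a
  add_zero : ∀ a : G, a + 0 = a
  neg_add : ∀ x : G, -x + x = 0
  add_neg : ∀ x : G, x + -x = 0
  gyroassoc : ∀ x y z : G, x + (y + z) = (x + y) + gyr x y z
  left_loop : ∀ x y : G, gyr (x + y) y = gyr x y

namespace Gyrogroup

theorem left_cancel {G : Type u} [Gyrogroup G] {a b c : G} (h : a + b = a + c) : b = c := by
  have h1 : -a + (a + b) = -a + (a + c) := by rw [h]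
  rw [gyroassoc, gyroassoc, neg_add, zero_add, zero_add] at h1
  exact (gyr (-a) a).injective h1

theorem zero_unique {G : Type u} [Gyrogroup G] {e : G} (h : ∀ a : G, e + a = a) : e = 0 := by
  rw [← add_zero e, h]

theorem neg_unique {G : Type u} [Gyrogroup G] {x y : G} (h : x + y = 0) : y = -x :=
  left_cancel (h.trans (add_neg x).symm)

theorem gyr_unique {G : Type u} [Gyrogroup G] {x y : G} (f : G → G)
    (h : ∀ z, x + (y + z) = (x + y) + f z) : f = gyr x y :=
  funext fun z => left_cancel ((h z).symm.trans (gyroassoc x y z))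

end Gyrogroup

/-- `H` is a subgyrogroup: it is closed under the operation of `G` and is a gyrogroup under the
restricted operation (hence nonempty).  That each `gyr[x, y]` restricts to a bijective
homomorphism from `H` onto its image `gyr[x, y](H)` is automatic, `gyr[x, y]` being an
automorphism. -/
def IsSubgyrogroup {G : Type u} [Gyrogroup G] (H : Set G) : Prop :=
  ∃ _ : Gyrogroup H, ∀ x y : H, ((x + y : H) : G) = (x : G) + (y : G)

/-- `H` is an `L`-subgyrogroup: `gyr[a, h](H) = H` for all `a` in `G` and `h` in `H`. -/
structure IsLSubgyrogroup {G : Type u} [Gyrogroup G] (H : Set G) : Prop where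
  isSubgyrogroup : IsSubgyrogroup H
  image_gyr : ∀ a : G, ∀ h ∈ H, Gyrogroup.gyr a h '' H = H

/-- The set `G/H` of left cosets `a + H = {a + h | h ∈ H}`. -/
def GyroCosetSpace {G : Type u} [Gyrogroup G] (H : Set G) : Type u :=
  {C : Set G // ∃ a : G, C = (fun h => a + h) '' H}

/-- The natural map `a ↦ a + H` from `G` onto `G/H`. -/
def GyroCosetSpace.mk {G : Type u} [Gyrogroup G] (H : Set G) (a : G) : GyroCosetSpace H :=
  ⟨(fun h => a + h) '' H, a, rfl⟩

/-- The quotient topology on `G/H`. -/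
instance GyroCosetSpace.instTopologicalSpace {G : Type u} [Gyrogroup G] [TopologicalSpace G]
    (H : Set G) : TopologicalSpace (GyroCosetSpace H) :=
  TopologicalSpace.coinduced (GyroCosetSpace.mk H) inferInstance

/-- A topological gyrogroup: the operation is jointly continuous and inversion is continuous. -/
class TopologicalGyrogroup (G : Type u) [TopologicalSpace G] [Gyrogroup G] : Prop extends
  ContinuousAdd G, ContinuousNeg G

/-- A strongly topological gyrogroup: a topological gyrogroup with a neighbourhood base at `0`
whose members are invariant under all gyroautomorphisms. -/
class StronglyTopologicalGyrogroup (G : Type u) [TopologicalSpace G] [Gyrogroup G] : Prop extends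
  TopologicalGyrogroup G where
  exists_base : ∃ 𝒰 : Set (Set G), (∀ U ∈ 𝒰, U ∈ nhds (0 : G)) ∧
    (∀ W ∈ nhds (0 : G), ∃ U ∈ 𝒰, U ⊆ W) ∧
    ∀ U ∈ 𝒰, ∀ x y : G, Gyrogroup.gyr x y '' U = U

/-- A Čech-complete space: a Tychonoff space homeomorphic to a `G_δ`-set in a compact Hausdorff
space. -/
def IsCechComplete (X : Type u) [TopologicalSpace X] : Prop :=
  T35Space X ∧ ∃ (K : Type u) (_ : TopologicalSpace K) (_ : CompactSpace K) (_ : T2Space K)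
    (S : Set K), IsGδ S ∧ Nonempty (X ≃ₜ S)

/-! A Tychonoff space is Čech-complete exactly when it has a complete sequence, an intrinsic
condition on ultrafilters (`isCechComplete_iff`). This condition pulls back along proper maps and
pushes forward along proper surjections, and for a metrizable space it means complete metrizability.
If `H` is a compact `L`-subgyrogroup, `G → G/H` is proper (`isProperMap_mk`), so completeness passes
both ways and paracompactness lifts from `G/H` to `G`.

It remains to find `H` with `G/H` metrizable. From a complete sequence, choose gyration-invariant
neighbourhoods `U n` of `0` with `U (n+1) + U (n+1) ⊆ U n` and `-U (n+1) ⊆ U n`, each inside a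
member of the `n`-th family. Their intersection `H` is compact, and the `U n` shrink to it. Gyration
invariance makes the relations `-x + y ∈ U n` a countable base of a uniformity, and on cosets this
uniformity induces the quotient topology. -/

open Filter Topology Set Uniformity

/-! ### Complete sequences and proper maps -/

/-- A sequence of families, each containing a neighbourhood of every point, such that every
ultrafilter meeting all of them converges. -/
def HasCompleteSequence (X : Type*) [TopologicalSpace X] : Prop :=
  ∃ 𝒜 : ℕ → Set (Set X), (∀ n x, ∃ A ∈ 𝒜 n, A ∈ 𝓝 x) ∧
    ∀ f : Ultrafilter X, (∀ n, ∃ A ∈ 𝒜 n, A ∈ f) → ∃ x, (f : Filter X) ≤ 𝓝 x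

namespace HasCompleteSequence

variable {X Y : Type*} [TopologicalSpace X] [TopologicalSpace Y]

theorem of_isInducing_isGδ_range [CompactSpace Y] [RegularSpace Y] {e : X → Y}
    (he : IsInducing e) (hr : IsGδ (range e)) : HasCompleteSequence X := by
  obtain ⟨O, hO, hrO⟩ := isGδ_iff_eq_iInter_nat.1 hr
  -- Closedness of `C` keeps the limit found in the compact space inside every `O n`, hence in the
  -- range.
  refine ⟨fun n => {A | ∃ C, IsClosed C ∧ C ⊆ O n ∧ e ⁻¹' C = A}, fun n x => ?_, fun f hf => ?_⟩
  · have hx : e x ∈ O n := mem_iInter.1 (hrO ▸ mem_range_self x) n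
    obtain ⟨C, hC, hCc, hCO⟩ := exists_mem_nhds_isClosed_subset ((hO n).mem_nhds hx)
    exact ⟨_, ⟨C, hCc, hCO, rfl⟩, he.continuous.continuousAt hC⟩
  · obtain ⟨y, -, hy⟩ := isCompact_univ.ultrafilter_le_nhds (f.map e) (by simp)
    have hyr : y ∈ range e := by
      rw [hrO]
      refine mem_iInter.2 fun n => ?_
      obtain ⟨_, ⟨C, hCc, hCO, rfl⟩, hCf⟩ := hf n
      exact hCO (hCc.mem_of_tendsto (f := e) (b := (f : Filter X)) hy hCf)
    obtain ⟨x, rfl⟩ := hyr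
    exact ⟨x, by rw [he.nhds_eq_comap]; exact map_le_iff_le_comap.1 hy⟩

/-- If `y` has, for every `n`, a neighbourhood with trace inside a member of `𝒜 n`, then an
ultrafilter on `X` tending to `y` converges in `X`; uniqueness of limits puts `y` in the range. -/
theorem isGδ_range [T2Space Y] (hX : HasCompleteSequence X) {e : X → Y} (he : IsDenseInducing e) :
    IsGδ (range e) := by
  obtain ⟨𝒜, h𝒜, hf⟩ := hX
  have key : range e = ⋂ n, ⋃₀ {V | IsOpen V ∧ ∃ A ∈ 𝒜 n, e ⁻¹' V ⊆ A} := by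
    apply subset_antisymm
    · rintro _ ⟨x, rfl⟩
      refine mem_iInter.2 fun n => ?_
      obtain ⟨A, hA, hAx⟩ := h𝒜 n x
      rw [he.isInducing.nhds_eq_comap] at hAx
      obtain ⟨V, hV, hVA⟩ := hAx
      obtain ⟨W, hWV, hW, hxW⟩ := mem_nhds_iff.1 hV
      exact ⟨W, ⟨hW, A, hA, (preimage_mono hWV).trans hVA⟩, hxW⟩
    · intro y hy
      have := he.comap_nhds_neBot y
      let f := Ultrafilter.of (comap e (𝓝 y))
      have hfle : (f : Filter X) ≤ comap e (𝓝 y) := Ultrafilter.of_le _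
      obtain ⟨x, hx⟩ := hf f fun n => by
        obtain ⟨V, ⟨hV, A, hA, hVA⟩, hyV⟩ := mem_iInter.1 hy n
        exact ⟨A, hA, hfle ⟨V, hV.mem_nhds hyV, hVA⟩⟩
      refine ⟨x, tendsto_nhds_unique (f := e) (l := (f : Filter X)) ?_ ?_⟩
      · exact (he.continuous.tendsto x).mono_left hx
      · exact tendsto_iff_comap.2 hfle
  rw [key]
  exact .iInter_of_isOpen fun n => isOpen_sUnion fun V hV => hV.1

theorem of_isProperMap {f : X → Y} (hf : IsProperMap f) (hY : HasCompleteSequence Y) :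
    HasCompleteSequence X := by
  obtain ⟨𝒜, h𝒜, hc⟩ := hY
  refine ⟨fun n => preimage f '' 𝒜 n, fun n x => ?_, fun u hu => ?_⟩
  · obtain ⟨A, hA, hAx⟩ := h𝒜 n (f x)
    exact ⟨_, ⟨A, hA, rfl⟩, hf.continuous.continuousAt hAx⟩
  · obtain ⟨y, hy⟩ := hc (u.map f) fun n => by
      obtain ⟨_, ⟨A, hA, rfl⟩, hAu⟩ := hu n
      exact ⟨A, hA, hAu⟩
    obtain ⟨x, -, hx⟩ := hf.ultrafilter_le_nhds_of_tendsto hy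
    exact ⟨x, hx⟩

end HasCompleteSequence

theorem IsProperMap.exists_isOpen_preimage_subset {X Y : Type*} [TopologicalSpace X]
    [TopologicalSpace Y] {f : X → Y} (hf : IsProperMap f) {y : Y} {U : Set X} (hU : IsOpen U)
    (h : f ⁻¹' {y} ⊆ U) : ∃ V, IsOpen V ∧ y ∈ V ∧ f ⁻¹' V ⊆ U := by
  refine ⟨(f '' Uᶜ)ᶜ, (hf.isClosedMap _ hU.isClosed_compl).isOpen_compl, ?_, ?_⟩
  · rintro ⟨x, hx, rfl⟩
    exact hx (h rfl)
  · intro x hx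
    by_contra hxU
    exact hx ⟨x, hxU, rfl⟩

namespace HasCompleteSequence

variable {X Y : Type*} [TopologicalSpace X] [TopologicalSpace Y]

theorem image_of_isProperMap {f : X → Y} (hf : IsProperMap f) (hs : Function.Surjective f)
    (hfib : ∀ y, IsCompact (f ⁻¹' {y})) (hX : HasCompleteSequence X) : HasCompleteSequence Y := by
  obtain ⟨𝒜, h𝒜, hc⟩ := hX
  -- A compact fibre needs finitely many members of `𝒜 n`; an ultrafilter containing their union
  -- contains one of them.
  refine ⟨fun n => {B | ∃ t : Set (Set X), t.Finite ∧ t ⊆ 𝒜 n ∧ f ⁻¹' B ⊆ ⋃₀ t},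
    fun n y => ?_, fun u hu => ?_⟩
  · choose A hA hAx using h𝒜 n
    obtain ⟨t, -, ht⟩ := (hfib y).elim_nhds_subcover (fun x => interior (A x))
      fun x _ => interior_mem_nhds.2 (hAx x)
    obtain ⟨V, hV, hyV, hVt⟩ := hf.exists_isOpen_preimage_subset
      (isOpen_biUnion fun x (_ : x ∈ t) => isOpen_interior (s := A x)) ht
    refine ⟨V, ⟨A '' t, t.finite_toSet.image A, ?_, hVt.trans ?_⟩, hV.mem_nhds hyV⟩
    · rintro _ ⟨x, -, rfl⟩
      exact hA x
    · refine iUnion₂_subset fun x hx => ?_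
      exact interior_subset.trans (subset_sUnion_of_mem ⟨x, hx, rfl⟩)
  · have : (comap f (u : Filter Y)).NeBot := u.neBot.comap_of_surj hs
    let v := Ultrafilter.of (comap f (u : Filter Y))
    have hv : (v : Filter X) ≤ comap f u := Ultrafilter.of_le _
    obtain ⟨x, hx⟩ := hc v fun n => by
      obtain ⟨B, ⟨t, htf, htA, hBt⟩, hB⟩ := hu n
      have : ⋃₀ t ∈ v := hv ⟨B, hB, hBt⟩
      obtain ⟨A, hAt, hAv⟩ := (Ultrafilter.finite_sUnion_mem_iff htf).1 this
      exact ⟨A, htA hAt, hAv⟩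
    refine ⟨f x, ?_⟩
    have h1 : v.map f = u := Ultrafilter.coe_le_coe.1 (map_le_iff_le_comap.2 hv)
    rw [← h1]
    exact (hf.continuous.tendsto x).mono_left hx

theorem of_completeSpace (X : Type*) [PseudoMetricSpace X] [CompleteSpace X] :
    HasCompleteSequence X := by
  refine ⟨fun n => range fun x : X => Metric.ball x (1 / (n + 1 : ℝ)), fun n x =>
    ⟨_, ⟨x, rfl⟩, Metric.ball_mem_nhds x (by positivity)⟩, fun f hf => ?_⟩
  refine CompleteSpace.complete (Metric.cauchy_iff.2 ⟨f.neBot, fun ε hε => ?_⟩)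
  obtain ⟨n, hn⟩ := exists_nat_one_div_lt (half_pos hε)
  obtain ⟨_, ⟨x, rfl⟩, hx⟩ := hf n
  refine ⟨_, hx, fun y hy z hz => ?_⟩
  rw [Metric.mem_ball] at hy hz
  linarith [dist_triangle_right y z x]

end HasCompleteSequence

/-! ### Complete metrizability and Čech-completeness -/

theorem IsGδ.isCompletelyMetrizableSpace {X : Type*} [MetricSpace X] [CompleteSpace X]
    {s : Set X} (hs : IsGδ s) : TopologicalSpace.IsCompletelyMetrizableSpace s := by
  obtain ⟨O, hO, rfl⟩ := isGδ_iff_eq_iInter_nat.1 hs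
  have : ∀ n, TopologicalSpace.IsCompletelyMetrizableSpace (O n) := fun n =>
    inferInstanceAs (TopologicalSpace.IsCompletelyMetrizableSpace
      (TopologicalSpace.Opens.CompleteCopy ⟨O n, hO n⟩))
  -- The diagonal map: its image is the set of constant sequences, closed in a countable product of
  -- completely metrizable spaces.
  let e : (⋂ n, O n : Set X) → ∀ n, O n := fun x n => ⟨x, mem_iInter.1 x.2 n⟩
  have he : Continuous e := by fun_prop
  have hc : IsClosedEmbedding e := by
    refine ⟨⟨⟨le_antisymm he.le_induced ?_⟩, fun x y h => ?_⟩, ?_⟩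
    · have h1 : Continuous fun y : ∀ n, O n => (y 0 : X) := by fun_prop
      calc TopologicalSpace.induced e inferInstance
          ≤ TopologicalSpace.induced e (TopologicalSpace.induced (fun y => (y 0 : X)) inferInstance) :=
            induced_mono h1.le_induced
        _ = _ := induced_compose
    · exact Subtype.ext (congrArg (fun y : ∀ n, O n => (y 0 : X)) h)
    · have : range e = {y | ∀ n, (y n : X) = y 0} := by
        ext y
        constructor
        · rintro ⟨x, rfl⟩ n
          rfl
        · intro h
          exact ⟨⟨y 0, mem_iInter.2 fun n => h n ▸ (y n).2⟩, funext fun n => Subtype.ext (h n).symm⟩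
      rw [this, ofPred_forall]
      exact isClosed_iInter fun n => isClosed_eq (by fun_prop) (by fun_prop)
  exact hc.IsCompletelyMetrizableSpace

theorem HasCompleteSequence.isCompletelyMetrizableSpace {X : Type*} [TopologicalSpace X]
    [TopologicalSpace.MetrizableSpace X] (hX : HasCompleteSequence X) :
    TopologicalSpace.IsCompletelyMetrizableSpace X := by
  let := TopologicalSpace.metrizableSpaceMetric X
  have he := UniformSpace.Completion.isDenseEmbedding_coe (α := X)
  have := (hX.isGδ_range he.toIsDenseInducing).isCompletelyMetrizableSpace
  exact he.isEmbedding.toHomeomorph.isClosedEmbedding.IsCompletelyMetrizableSpace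

theorem isCechComplete_iff {X : Type*} [TopologicalSpace X] :
    IsCechComplete X ↔ T35Space X ∧ HasCompleteSequence X := by
  constructor
  · rintro ⟨hX, K, _, _, _, S, hS, ⟨e⟩⟩
    refine ⟨hX, .of_isInducing_isGδ_range (IsInducing.subtypeVal.comp e.isInducing) ?_⟩
    rwa [range_comp, e.range_coe, image_univ, Subtype.range_coe]
  · rintro ⟨hX, hc⟩
    have he := isDenseEmbedding_stoneCechUnit (X := X)
    exact ⟨hX, StoneCech X, inferInstance, inferInstance, inferInstance, _,
      hc.isGδ_range he.toIsDenseInducing, ⟨he.isEmbedding.toHomeomorph⟩⟩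

/-- Each fibre meets a finite subcover that still covers a tube `f ⁻¹' V`. Pulling back a locally
finite refinement of the `V`'s and cutting by these finite subfamilies keeps local finiteness. -/
theorem IsProperMap.paracompactSpace {X Y : Type u} [TopologicalSpace X] [TopologicalSpace Y]
    [ParacompactSpace Y] {f : X → Y} (hf : IsProperMap f) (hfib : ∀ y, IsCompact (f ⁻¹' {y})) :
    ParacompactSpace X := by
  refine ⟨fun ι U hU hc => ?_⟩
  have h1 : ∀ y, ∃ t : Finset ι, f ⁻¹' {y} ⊆ ⋃ i ∈ t, U i := fun y =>
    (hfib y).elim_finite_subcover U hU (by rw [hc]; exact subset_univ _)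
  choose t ht using h1
  choose V hVo hyV hVt using fun y =>
    hf.exists_isOpen_preimage_subset (isOpen_biUnion fun i (_ : i ∈ t y) => hU i) (ht y)
  obtain ⟨W, hWo, hWc, hWf, hWV⟩ := precise_refinement V hVo
    (eq_univ_of_forall fun y => mem_iUnion.2 ⟨y, hyV y⟩)
  refine ⟨Σ y, t y, fun p => f ⁻¹' W p.1 ∩ U p.2, fun p =>
    ((hWo _).preimage hf.continuous).inter (hU _), ?_, ?_, fun p => ⟨_, inter_subset_right⟩⟩
  · refine eq_univ_of_forall fun x => ?_
    obtain ⟨y, hy⟩ := mem_iUnion.1 (hWc ▸ mem_univ (f x) : f x ∈ ⋃ y, W y)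
    obtain ⟨i, hi, hxi⟩ := mem_iUnion₂.1 (hVt y (hWV y hy : x ∈ f ⁻¹' V y))
    exact mem_iUnion.2 ⟨⟨y, i, hi⟩, hy, hxi⟩
  · intro x
    obtain ⟨N, hN, hfin⟩ := hWf (f x)
    refine ⟨f ⁻¹' N, hf.continuous.continuousAt hN, ?_⟩
    have : (⋃ y ∈ {y | (W y ∩ N).Nonempty},
        range fun i : t y => (⟨y, i⟩ : Σ y, t y)).Finite :=
      hfin.biUnion fun y _ => finite_range _
    refine this.subset ?_
    rintro ⟨y, i⟩ ⟨z, ⟨hz, -⟩, hzN⟩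
    exact mem_iUnion₂.2 ⟨y, ⟨f z, hz, hzN⟩, i, rfl⟩

/-! ### Gyrogroup identities and the left uniformity -/

namespace Gyrogroup

variable {G : Type*} [Gyrogroup G]

theorem gyr_zero_left (y z : G) : gyr 0 y z = z := by
  have h := gyroassoc 0 y z
  rw [zero_add, zero_add] at h
  exact (left_cancel h).symm

theorem gyr_neg_self (y z : G) : gyr (-y) y z = z := by
  rw [← left_loop, neg_add, gyr_zero_left]

theorem neg_neg (x : G) : - -x = x := (neg_unique (neg_add x)).symm

theorem neg_add_self_add (a b : G) : -a + (a + b) = b := by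
  rw [gyroassoc, neg_add, zero_add, gyr_neg_self]

theorem add_neg_add (a b : G) : a + (-a + b) = b := by
  simpa only [neg_neg] using neg_add_self_add (-a) b

theorem neg_zero : -(0 : G) = 0 := (neg_unique (zero_add 0)).symm

theorem gyr_zero_right (x y : G) : gyr x y 0 = 0 := by
  have h := gyroassoc x y 0
  rw [add_zero, ← add_zero (x + y), add_zero, ← add_zero (x + y)] at h
  rw [add_zero (x + y)] at h
  exact (left_cancel ((add_zero _).trans h)).symm

theorem gyr_neg (x y z : G) : gyr x y (-z) = -gyr x y z :=
  neg_unique (by rw [← map_add, add_neg, gyr_zero_right])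

/-- Left translations preserve left differences up to a gyroautomorphism. -/
theorem neg_add_add (x a b : G) : -(x + a) + (x + b) = gyr x a (-a + b) := by
  have h : x + b = (x + a) + gyr x a (-a + b) := by rw [← gyroassoc, add_neg_add]
  rw [h, neg_add_self_add]

theorem neg_add_comm (x y : G) : -y + x = -gyr x (-x + y) (-x + y) := by
  have h := neg_add_add x (-x + y) 0
  rwa [add_neg_add, add_zero, add_zero, gyr_neg] at h

theorem neg_add_trans (x y z : G) : -x + z = (-x + y) + gyr (-x) y (-y + z) := by
  rw [← gyroassoc, add_neg_add]

/-- The left uniformity attached to a filter playing the role of the neighbourhoods of zero. -/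
def leftUniformCore (F : Filter G) (h0 : pure 0 ≤ F)
    (hgyr : ∀ V ∈ F, ∃ U ∈ F, U ⊆ V ∧ ∀ x y, gyr x y '' U = U)
    (hneg : Tendsto (fun x : G => -x) F F)
    (hadd : Tendsto (fun p : G × G => p.1 + p.2) (F ×ˢ F) F) : UniformSpace.Core G :=
  .mk' (comap (fun p : G × G => -p.1 + p.2) F)
    (by
      rintro r ⟨V, hV, hVr⟩ x
      apply hVr
      show -x + x ∈ V
      rw [neg_add]
      exact h0 hV)
    (by
      rintro r ⟨V, hV, hVr⟩
      obtain ⟨U, hU, hUV, hUg⟩ := hgyr _ (hneg hV)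
      refine ⟨U, hU, fun p hp => hVr ?_⟩
      show -p.2 + p.1 ∈ V
      -- Reversing a left difference negates it up to a gyration, which `U` absorbs.
      rw [neg_add_comm]
      exact hUV ((hUg _ _).subset (mem_image_of_mem _ hp)))
    (by
      rintro r ⟨V, hV, hVr⟩
      obtain ⟨W, hW, hWV⟩ := mem_prod_same_iff.1 (hadd hV)
      obtain ⟨U, hU, hUW, hUg⟩ := hgyr W hW
      refine ⟨_, ⟨U, hU, subset_rfl⟩, ?_⟩
      rintro ⟨x, z⟩ ⟨y, hxy, hyz⟩
      apply hVr
      show -x + z ∈ V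
      rw [neg_add_trans x y z]
      exact hWV (mk_mem_prod (hUW hxy) (hUW ((hUg _ _).subset (mem_image_of_mem _ hyz)))))

end Gyrogroup

open Gyrogroup

section StronglyTopological

variable {G : Type*} [TopologicalSpace G] [Gyrogroup G]

theorem nhds_eq_comap_neg_add [TopologicalGyrogroup G] (x : G) :
    𝓝 x = comap (fun y => -x + y) (𝓝 0) := by
  apply le_antisymm
  · refine tendsto_iff_comap.1 ?_
    have : Continuous fun y : G => -x + y := by fun_prop
    simpa only [Gyrogroup.neg_add] using this.tendsto x
  · intro s hs
    have : Continuous fun y : G => x + y := by fun_prop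
    refine ⟨(fun y => x + y) ⁻¹' s, this.continuousAt (by rwa [Gyrogroup.add_zero]), fun y hy => ?_⟩
    simpa only [mem_preimage, Gyrogroup.add_neg_add] using hy

theorem exists_gyr_invariant_nhds [StronglyTopologicalGyrogroup G] {V : Set G}
    (hV : V ∈ 𝓝 (0 : G)) : ∃ U ∈ 𝓝 (0 : G), U ⊆ V ∧ ∀ x y, gyr x y '' U = U := by
  obtain ⟨𝒰, h1, h2, h3⟩ := StronglyTopologicalGyrogroup.exists_base (G := G)
  obtain ⟨U, hU, hUV⟩ := h2 V hV
  exact ⟨U, h1 U hU, hUV, h3 U hU⟩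

theorem tendsto_neg_nhds_zero [TopologicalGyrogroup G] :
    Tendsto (fun x : G => -x) (𝓝 0) (𝓝 0) := by
  simpa only [Gyrogroup.neg_zero] using (continuous_neg (G := G)).tendsto 0

theorem tendsto_add_nhds_zero [TopologicalGyrogroup G] :
    Tendsto (fun p : G × G => p.1 + p.2) (𝓝 0 ×ˢ 𝓝 0) (𝓝 0) := by
  rw [← nhds_prod_eq]
  simpa only [Gyrogroup.add_zero] using (continuous_add (M := G)).tendsto (0, 0)

/-- The invariant base makes the topology uniformizable by left differences, hence completely
regular. -/
theorem StronglyTopologicalGyrogroup.t35Space [T1Space G] [StronglyTopologicalGyrogroup G] :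
    T35Space G := by
  let c : UniformSpace.Core G := leftUniformCore (𝓝 0) (pure_le_nhds 0)
    (fun V hV => exists_gyr_invariant_nhds hV) tendsto_neg_nhds_zero tendsto_add_nhds_zero
  have h : ‹TopologicalSpace G› = c.toTopologicalSpace := TopologicalSpace.ext_nhds fun x => by
    rw [c.nhds_toTopologicalSpace, nhds_eq_comap_neg_add x]
    exact (comap_comap (f := 𝓝 (0 : G)) (m := Prod.mk x) (n := fun p : G × G => -p.1 + p.2)).symm
  let := UniformSpace.ofCoreEq c _ h
  exact {}

end StronglyTopological

/-! ### Subgyrogroups and coset spaces -/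

theorem IsSubgyrogroup.zero_mem {G : Type*} [Gyrogroup G] {H : Set G} (hH : IsSubgyrogroup H) :
    (0 : G) ∈ H := by
  obtain ⟨_, h⟩ := hH
  have h1 := h 0 0
  rw [Gyrogroup.add_zero] at h1
  -- The identity of `H` is idempotent in `G`, so left cancellation identifies it with `0`.
  rw [left_cancel ((Gyrogroup.add_zero _).trans h1)]
  exact Subtype.coe_prop _

theorem IsSubgyrogroup.add_mem {G : Type*} [Gyrogroup G] {H : Set G} (hH : IsSubgyrogroup H)
    {x y : G} (hx : x ∈ H) (hy : y ∈ H) : x + y ∈ H := by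
  obtain ⟨_, h⟩ := hH
  rw [← h ⟨x, hx⟩ ⟨y, hy⟩]
  exact Subtype.coe_prop _

theorem IsSubgyrogroup.neg_mem {G : Type*} [Gyrogroup G] {H : Set G} (hH : IsSubgyrogroup H)
    {x : G} (hx : x ∈ H) : -x ∈ H := by
  obtain ⟨_, h⟩ := hH
  have h0 : ((0 : H) : G) = 0 := by
    have h1 := h 0 0
    rw [Gyrogroup.add_zero] at h1
    exact (left_cancel ((Gyrogroup.add_zero _).trans h1)).symm
  have h1 := h ⟨x, hx⟩ (-⟨x, hx⟩)
  rw [Gyrogroup.add_neg, h0] at h1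
  rw [← neg_unique h1.symm]
  exact Subtype.coe_prop _

/-- A gyration-invariant set closed under the operations is an `L`-subgyrogroup. -/
theorem IsLSubgyrogroup.of_invariant {G : Type*} [Gyrogroup G] {H : Set G} (h0 : (0 : G) ∈ H)
    (hadd : ∀ x ∈ H, ∀ y ∈ H, x + y ∈ H) (hneg : ∀ x ∈ H, -x ∈ H)
    (hgyr : ∀ x y : G, gyr x y '' H = H) : IsLSubgyrogroup H where
  image_gyr a h _ := hgyr a h
  isSubgyrogroup := by
    have hmem : ∀ x y z : G, gyr x y z ∈ H ↔ z ∈ H := fun x y z => by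
      conv_lhs => rw [← hgyr x y]
      exact (gyr x y).injective.mem_set_image
    let : Add H := ⟨fun x y => ⟨x + y, hadd _ x.2 _ y.2⟩⟩
    refine ⟨{
      add := fun x y => ⟨x + y, hadd _ x.2 _ y.2⟩
      zero := ⟨0, h0⟩
      neg := fun x => ⟨-x, hneg _ x.2⟩
      gyr := fun x y => {
        toFun := fun z => ⟨gyr (x : G) y z, (hmem _ _ _).2 z.2⟩
        invFun := fun z => ⟨(gyr (x : G) y).symm z, (hmem x y _).1 (by simp)⟩
        left_inv := fun z => by simp
        right_inv := fun z => by simp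
        map_add' := fun z w => Subtype.ext (map_add (gyr (x : G) y) (z : G) w) }
      zero_add := fun a => Subtype.ext (Gyrogroup.zero_add _)
      add_zero := fun a => Subtype.ext (Gyrogroup.add_zero _)
      neg_add := fun a => Subtype.ext (Gyrogroup.neg_add _)
      add_neg := fun a => Subtype.ext (Gyrogroup.add_neg _)
      gyroassoc := fun x y z => Subtype.ext (Gyrogroup.gyroassoc _ _ _)
      left_loop := fun x y => AddEquiv.ext fun z => Subtype.ext
        (DFunLike.congr_fun (Gyrogroup.left_loop (x : G) y) (z : G)) }, fun x y => rfl⟩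

namespace GyroCosetSpace

variable {G : Type*} [Gyrogroup G] {H : Set G}

theorem mk_surjective : Function.Surjective (mk H) := by
  rintro ⟨_, a, rfl⟩
  exact ⟨a, rfl⟩

theorem mem_mk {a x : G} : x ∈ (mk H a).1 ↔ -a + x ∈ H := by
  constructor
  · rintro ⟨h, hh, rfl⟩
    rwa [neg_add_self_add]
  · exact fun h => ⟨_, h, add_neg_add a x⟩

theorem mk_eq_mk (hH : IsLSubgyrogroup H) {a b : G} : mk H a = mk H b ↔ -a + b ∈ H := by
  have h0 := hH.isSubgyrogroup.zero_mem
  constructor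
  · intro h
    rw [← mem_mk, h, mem_mk, Gyrogroup.neg_add]
    exact h0
  · intro h
    have hg : ∀ z, gyr a (-a + b) z ∈ H ↔ z ∈ H := fun z => by
      conv_lhs => rw [← hH.image_gyr a _ h]
      exact (gyr a (-a + b)).injective.mem_set_image
    apply Subtype.ext
    ext x
    rw [mem_mk, mem_mk]
    -- The gyration has second argument in `H`, so the `L`-condition applies to it.
    have key : -b + x = gyr a (-a + b) (-(-a + b) + (-a + x)) := by
      rw [← neg_add_add, add_neg_add, add_neg_add]
    rw [key, hg]
    constructor
    · exact fun hx => hH.isSubgyrogroup.add_mem (hH.isSubgyrogroup.neg_mem h) hx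
    · intro hx
      have := hH.isSubgyrogroup.add_mem h hx
      rwa [add_neg_add] at this

theorem preimage_mk_singleton (hH : IsLSubgyrogroup H) (a : G) :
    mk H ⁻¹' {mk H a} = (fun h => a + h) '' H := by
  ext x
  rw [mem_preimage, mem_singleton_iff, eq_comm, mk_eq_mk hH, ← mem_mk]
  rfl

variable [TopologicalSpace G]

theorem continuous_mk : Continuous (mk H) := continuous_coinduced_rng

theorem isCompact_preimage_mk [TopologicalGyrogroup G] (hH : IsLSubgyrogroup H)
    (hc : IsCompact H) (y : GyroCosetSpace H) : IsCompact (mk H ⁻¹' {y}) := by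
  obtain ⟨a, rfl⟩ := mk_surjective y
  rw [preimage_mk_singleton hH]
  exact hc.image (by fun_prop)

theorem isProperMap_mk [TopologicalGyrogroup G] (hH : IsLSubgyrogroup H) (hc : IsCompact H) :
    IsProperMap (mk H) := by
  refine isProperMap_iff_isClosedMap_and_compact_fibers.2
    ⟨continuous_mk, fun C hC => ?_, fun y => isCompact_preimage_mk hH hc y⟩
  rw [← isOpen_compl_iff, isOpen_coinduced]
  -- The points whose whole coset avoids `C`; compactness of `H` makes this set open.
  have : mk H ⁻¹' (mk H '' C)ᶜ = {x | ∀ h ∈ H, x + h ∈ Cᶜ} := by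
    ext x
    constructor
    · intro hx h hh hxh
      refine hx ⟨x + h, hxh, ((mk_eq_mk hH).2 ?_).symm⟩
      rwa [neg_add_self_add]
    · rintro hx ⟨c, hcC, hcx⟩
      refine hx _ ((mk_eq_mk hH).1 hcx.symm) ?_
      rwa [add_neg_add]
  rw [this, isOpen_iff_eventually]
  intro x hx
  refine hc.eventually_forall_of_forall_eventually fun h hh => ?_
  have hcont : Continuous fun p : G × G => p.1 + p.2 := continuous_add
  exact hcont.continuousAt (hC.isOpen_compl.mem_nhds (hx h hh))

end GyroCosetSpace

/-! ### The compact subgyrogroup and its metrizable quotient -/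

/-- A sequence of gyration-invariant neighbourhoods of zero, each absorbing the sums and the
negatives of the next one, such that every ultrafilter containing all of them converges. -/
structure IsCompleteNhdsSeq {G : Type*} [TopologicalSpace G] [Gyrogroup G] (U : ℕ → Set G) :
    Prop where
  mem_nhds : ∀ n, U n ∈ 𝓝 (0 : G)
  image_gyr : ∀ n x y, gyr x y '' U n = U n
  neg_mem : ∀ n, ∀ x ∈ U (n + 1), -x ∈ U n
  add_mem : ∀ n, ∀ x ∈ U (n + 1), ∀ y ∈ U (n + 1), x + y ∈ U n
  exists_le_nhds : ∀ f : Ultrafilter G, (∀ n, U n ∈ f) → ∃ x, (f : Filter G) ≤ 𝓝 x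

theorem HasCompleteSequence.exists_isCompleteNhdsSeq {G : Type*} [TopologicalSpace G]
    [Gyrogroup G] [StronglyTopologicalGyrogroup G] (hG : HasCompleteSequence G) :
    ∃ U : ℕ → Set G, IsCompleteNhdsSeq U := by
  obtain ⟨𝒜, h𝒜, hc⟩ := hG
  choose A hA hA0 using fun n => h𝒜 n (0 : G)
  have step : ∀ (n : ℕ) (V : {V : Set G // V ∈ 𝓝 (0 : G)}), ∃ U : {V : Set G // V ∈ 𝓝 (0 : G)},
      (∀ x y, gyr x y '' U.1 = U.1) ∧ (∀ x ∈ U.1, -x ∈ V.1) ∧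
        (∀ x ∈ U.1, ∀ y ∈ U.1, x + y ∈ V.1) ∧ U.1 ⊆ A n := by
    rintro n ⟨V, hV⟩
    obtain ⟨W, hW, hWV⟩ := mem_prod_same_iff.1 (tendsto_add_nhds_zero hV)
    obtain ⟨U, hU, hUV, hUg⟩ := exists_gyr_invariant_nhds
      (inter_mem (tendsto_neg_nhds_zero hV) (inter_mem hW (hA0 n)))
    exact ⟨⟨U, hU⟩, hUg, fun x hx => (hUV hx).1,
      fun x hx y hy => hWV (mk_mem_prod (hUV hx).2.1 (hUV hy).2.1), fun x hx => (hUV hx).2.2⟩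
  choose S hSg hSn hSa hSA using step
  -- Starting at `S 0 univ` makes every term a value of `S n`, so `T 0` is also invariant and inside
  -- `A 0`.
  let T : ℕ → {V : Set G // V ∈ 𝓝 (0 : G)} :=
    fun n => Nat.rec (S 0 ⟨univ, univ_mem⟩) (fun n V => S (n + 1) V) n
  have hT : ∀ n, ∃ V, T n = S n V := by
    rintro (_ | n)
    exacts [⟨_, rfl⟩, ⟨T n, rfl⟩]
  refine ⟨fun n => (T n).1, fun n => (T n).2, fun n => ?_, fun n => hSn (n + 1) (T n),
    fun n => hSa (n + 1) (T n), fun f hf => hc f fun n => ⟨A n, hA n, ?_⟩⟩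
  · obtain ⟨V, hV⟩ := hT n
    simp only [hV]
    exact hSg n V
  · obtain ⟨V, hV⟩ := hT n
    have := hf n
    simp only [hV] at this
    exact mem_of_superset this (hSA n V)

namespace IsCompleteNhdsSeq

variable {G : Type*} [TopologicalSpace G] [Gyrogroup G] {U : ℕ → Set G}

theorem zero_mem (hU : IsCompleteNhdsSeq U) (n : ℕ) : (0 : G) ∈ U n :=
  mem_of_mem_nhds (hU.mem_nhds n)

theorem antitone (hU : IsCompleteNhdsSeq U) : Antitone U :=
  antitone_nat_of_succ_le fun n x hx => by
    have := hU.add_mem n x hx 0 (hU.zero_mem _)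
    rwa [Gyrogroup.add_zero] at this

theorem isLSubgyrogroup (hU : IsCompleteNhdsSeq U) : IsLSubgyrogroup (⋂ n, U n) := by
  refine .of_invariant (mem_iInter.2 hU.zero_mem) (fun x hx y hy => ?_) (fun x hx => ?_)
    fun x y => ?_
  · rw [mem_iInter] at *
    exact fun n => hU.add_mem n x (hx _) y (hy _)
  · rw [mem_iInter] at *
    exact fun n => hU.neg_mem n x (hx _)
  · rw [image_iInter (gyr x y).bijective]
    exact iInter_congr fun n => hU.image_gyr n x y

/-- This places limits of ultrafilters containing all `U n` in the intersection. -/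
theorem closure_subset [TopologicalGyrogroup G] (hU : IsCompleteNhdsSeq U) (n : ℕ) :
    closure (U (n + 1)) ⊆ U n := by
  intro x hx
  have hc : Continuous fun y : G => -y + x := by fun_prop
  have hN : (fun y : G => -y + x) ⁻¹' U (n + 1) ∈ 𝓝 x :=
    hc.continuousAt (by simpa only [Gyrogroup.neg_add] using hU.mem_nhds (n + 1))
  obtain ⟨y, hy, hyU⟩ := mem_closure_iff_nhds.1 hx _ hN
  rw [← add_neg_add y x]
  exact hU.add_mem n _ hyU _ hy

theorem exists_mem_iInter [TopologicalGyrogroup G] (hU : IsCompleteNhdsSeq U) (f : Ultrafilter G)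
    (hf : ∀ n, U n ∈ f) : ∃ x ∈ ⋂ n, U n, (f : Filter G) ≤ 𝓝 x := by
  obtain ⟨x, hx⟩ := hU.exists_le_nhds f hf
  exact ⟨x, mem_iInter.2 fun n => hU.closure_subset n
    (mem_closure_iff_ultrafilter.2 ⟨f, hf _, hx⟩), hx⟩

theorem isCompact [TopologicalGyrogroup G] (hU : IsCompleteNhdsSeq U) : IsCompact (⋂ n, U n) := by
  refine isCompact_iff_ultrafilter_le_nhds.2 fun f hf => hU.exists_mem_iInter f fun n => ?_
  exact mem_of_superset (le_principal_iff.1 hf) (iInter_subset U n)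

/-- Otherwise an ultrafilter containing every `U n ∩ Wᶜ` would converge to a point of the
intersection, hence of `W`. -/
theorem exists_subset [TopologicalGyrogroup G] (hU : IsCompleteNhdsSeq U) {W : Set G}
    (hW : IsOpen W) (h : ⋂ n, U n ⊆ W) : ∃ n, U n ⊆ W := by
  by_contra! hne
  have : (⨅ n, 𝓟 (U n ∩ Wᶜ)).NeBot := by
    refine iInf_neBot_of_directed' ?_ fun n => principal_neBot_iff.2 ?_
    · exact directed_of_isDirected_le fun m n hmn =>
        principal_mono.2 (inter_subset_inter_left _ (hU.antitone hmn))
    · exact inter_compl_nonempty_iff.2 (hne n)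
  have hle := Ultrafilter.of_le (⨅ n, 𝓟 (U n ∩ Wᶜ))
  have hmem : ∀ n, U n ∩ Wᶜ ∈ Ultrafilter.of (⨅ n, 𝓟 (U n ∩ Wᶜ)) := fun n =>
    hle (mem_iInf_of_mem n (mem_principal_self _))
  obtain ⟨x, hx, hfx⟩ := hU.exists_mem_iInter _ fun n => mem_of_superset (hmem n) inter_subset_left
  have hWx := hfx (hW.mem_nhds (h hx))
  obtain ⟨y, hy, hy'⟩ := Ultrafilter.nonempty_of_mem (inter_mem (hmem 0) hWx)
  exact hy.2 hy'

theorem metrizableSpace [TopologicalGyrogroup G] (hU : IsCompleteNhdsSeq U) :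
    TopologicalSpace.MetrizableSpace (GyroCosetSpace (⋂ n, U n)) := by
  set H : Set G := ⋂ n, U n
  have hH : IsLSubgyrogroup H := hU.isLSubgyrogroup
  have hHU : ∀ n, H ⊆ U n := iInter_subset U
  have hbasis : (⨅ n, 𝓟 (U n)).HasBasis (fun _ => True) U :=
    hasBasis_iInf_principal (directed_of_isDirected_le fun m n hmn => hU.antitone hmn)
  let c : UniformSpace.Core G := leftUniformCore (⨅ n, 𝓟 (U n))
    (hbasis.ge_iff.2 fun n _ => hU.zero_mem n)
    (fun V hV => by
      obtain ⟨n, -, hn⟩ := hbasis.mem_iff.1 hV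
      exact ⟨U n, hbasis.mem_of_mem trivial, hn, hU.image_gyr n⟩)
    (hbasis.tendsto_iff hbasis |>.2 fun n _ => ⟨n + 1, trivial, hU.neg_mem n⟩)
    (hbasis.prod_self.tendsto_iff hbasis |>.2 fun n _ =>
      ⟨n + 1, trivial, fun p hp => hU.add_mem n _ hp.1 _ hp.2⟩)
  -- Any section will do: changing representatives moves by elements of `H`, which lies in every `U
  -- n`.
  let s : GyroCosetSpace H → G := Function.surjInv GyroCosetSpace.mk_surjective
  have hs : ∀ y, GyroCosetSpace.mk H (s y) = y := Function.surjInv_eq _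
  let u : UniformSpace (GyroCosetSpace H) := UniformSpace.comap s (.ofCore c)
  have hub : 𝓤[u].HasBasis (fun _ => True) fun n => {p | -(s p.1) + s p.2 ∈ U n} :=
    (hbasis.comap fun p : G × G => -p.1 + p.2).comap (Prod.map s s)
  have htop : GyroCosetSpace.instTopologicalSpace H = u.toTopologicalSpace := by
    ext W
    rw [isOpen_coinduced, @isOpen_iff_mem_nhds _ u.toTopologicalSpace W]
    simp only [(nhds_basis_uniformity' hub).mem_iff, true_and]
    constructor
    · intro hW y hy
      have hc : Continuous fun h : G => s y + h := by fun_prop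
      obtain ⟨n, hn⟩ := hU.exists_subset (hW.preimage hc) fun h hh => by
        show GyroCosetSpace.mk H (s y + h) ∈ W
        rwa [← (GyroCosetSpace.mk_eq_mk hH).2 (show -(s y) + (s y + h) ∈ H by
          rwa [neg_add_self_add]), hs]
      refine ⟨n, fun z hz => ?_⟩
      have := hn hz
      rwa [mem_preimage, mem_preimage, add_neg_add, hs] at this
    · intro hW
      refine isOpen_iff_mem_nhds.2 fun x hx => ?_
      obtain ⟨n, hn⟩ := hW _ hx
      have hc : Continuous fun x' : G => -x + x' := by fun_prop
      -- Two levels pay for two uses of `htrans`, along `s (mk x)`, `x`, `x'`, `s (mk x')`.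
      have hN : (fun x' : G => -x + x') ⁻¹' U (n + 2) ∈ 𝓝 x :=
        hc.continuousAt (by simpa only [Gyrogroup.neg_add] using hU.mem_nhds (n + 2))
      refine mem_of_superset hN fun x' hx' => hn ?_
      show -(s (GyroCosetSpace.mk H x)) + s (GyroCosetSpace.mk H x') ∈ U n
      have htrans : ∀ n (a b d : G), -a + b ∈ U (n + 1) → -b + d ∈ U (n + 1) → -a + d ∈ U n := by
        intro n a b d hab hbd
        rw [neg_add_trans a b d]
        exact hU.add_mem n _ hab _ ((hU.image_gyr _ _ _).subset (mem_image_of_mem _ hbd))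
      refine htrans n _ x _ (hHU _ ((GyroCosetSpace.mk_eq_mk hH).1 (hs _)))
        (htrans _ _ x' _ hx' (hHU _ ((GyroCosetSpace.mk_eq_mk hH).1 (hs _).symm)))
  have hcount : IsCountablyGenerated 𝓤[u] := hub.isCountablyGenerated
  rw [htop]
  have hT0 : @T0Space (GyroCosetSpace H) u.toTopologicalSpace := by
    refine (@t0Space_iff_uniformity _ u).2 fun y z hyz => ?_
    rw [← hs y, ← hs z, GyroCosetSpace.mk_eq_mk hH]
    exact mem_iInter.2 fun n => hyz _ (hub.mem_of_mem (i := n) trivial)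
  exact @UniformSpace.metrizableSpace _ u hcount hT0

end IsCompleteNhdsSeq

theorem mainTheorem4 {G : Type u} [TopologicalSpace G] [T1Space G] [Gyrogroup G]
    [StronglyTopologicalGyrogroup G] :
    (IsCechComplete G ↔
      ∃ H : Set G, IsLSubgyrogroup H ∧ IsCompact H ∧
        TopologicalSpace.IsCompletelyMetrizableSpace (GyroCosetSpace H)) ∧
    (IsCechComplete G → ParacompactSpace G) := by
  have key : IsCechComplete G → ∃ H : Set G, IsLSubgyrogroup H ∧ IsCompact H ∧
      TopologicalSpace.IsCompletelyMetrizableSpace (GyroCosetSpace H) := by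
    intro hG
    have hc := (isCechComplete_iff.1 hG).2
    obtain ⟨U, hU⟩ := hc.exists_isCompleteNhdsSeq
    have := hU.metrizableSpace
    exact ⟨_, hU.isLSubgyrogroup, hU.isCompact, (hc.image_of_isProperMap
      (GyroCosetSpace.isProperMap_mk hU.isLSubgyrogroup hU.isCompact) GyroCosetSpace.mk_surjective
      (GyroCosetSpace.isCompact_preimage_mk hU.isLSubgyrogroup hU.isCompact)
      ).isCompletelyMetrizableSpace⟩
  refine ⟨⟨key, ?_⟩, fun hG => ?_⟩
  · rintro ⟨H, hH, hHc, hm⟩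
    let := TopologicalSpace.upgradeIsCompletelyMetrizable (GyroCosetSpace H)
    exact isCechComplete_iff.2 ⟨StronglyTopologicalGyrogroup.t35Space,
      (HasCompleteSequence.of_completeSpace _).of_isProperMap
        (GyroCosetSpace.isProperMap_mk hH hHc)⟩
  · obtain ⟨H, hH, hHc, hm⟩ := key hG
    let := TopologicalSpace.upgradeIsCompletelyMetrizable (GyroCosetSpace H)
    exact (GyroCosetSpace.isProperMap_mk hH hHc).paracompactSpace
      (GyroCosetSpace.isCompact_preimage_mk hH hHc)
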